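/- Let $X$ be a countably infinite set and let $(b,c)$ be a connected weighted graph over $X$: $b:X\times X\to[0,\infty)$ is symmetric, vanishes on the diagonal and satisfies $\sum_y b(x,y)<\infty$ for all $x$; $c:X\to[0,\infty)$; and any two vertices are joined by a finite path of edges, i.e. of pairs with $b>0$. For $f:X\to\mathbb R$ put $$\widetilde Q(f)=\tfrac12\sum_{x,y\in X}b(x,y)(f(x)-f(y))^2+\sum_{x\in X}c(x)f(x)^2\in[0,\infty],\qquad \widetilde D=\{f:\widetilde Q(f)<\infty\}.$$ Write $\widetilde Q(\cdot,\cdot)$ also for the polarization of $\widetilde Q$ on $\widetilde D$. For $o\in X$ let $\|\cdot\|_o$ be the norm on $\widetilde D$ given by the inner product $\langle f,g\rangle_o=\widetilde Q(f,g)+f(o)g(o)$, so that $\|f\|_o^2=\widetilde Q(f)+f(o)^2$. Let $D_0$ be the $\|\cdot\|_o$-closure in $\widetilde D$ of the finitely supported functions (it does not depend on $o$). The graph is transient if every $f\in D_0$ with $\widetilde Q(f)=0$ is $0$. A function $h$ with $\sum_y b(x,y)|h(y)|<\infty$ for all $x$ is harmonic if $\sum_y b(x,y)(h(x)-h(y))+c(x)h(x)=0$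 for all $x$. Let $\mathcal A$ be the uniform closure of $\widetilde D\cap\ell^\infty(X)$ in $\ell^\infty(X)$, let $\mathcal A^+$ be the algebra generated by $\mathcal A$ and the constant $1$, and let $R$ be the Royden compactification, i.e. the Gelfand spectrum of $\mathcal A^+$. Functions in $\mathcal A^+$ are identified with continuous functions on $R$, and $X$ is identified with the set of point evaluations in $R$. Let $$\partial X=R\setminus X,\qquad \partial_hX=\{z\in\partial X: f(z)=0\text{ for all }f\in D_0\cap\ell^\infty(X)\},$$ and let $\gamma_0:\mathcal A\to C(\partial_hX)$ be the restriction $f\mapsto f|_{\partial_hX}$. A harmonic measure at $x\in X$ is a regular Borel measure $\mu_x$ on $\partial_hX$ with $\mu_x(\partial_hX)\le1$ such that $h(x)=\int_{\partial_hX}\gamma_0h\,d\mu_x$ for every harmonic $h\in\widetilde D\cap\ell^\infty(X)$, and such that, if $1\notin\mathcal A$, $\mu_x(\{p_\infty\})=0$ for the point $p_\infty$ at which all functions in $\mathcal A$ vanish. A harmonic measure is a harmonic measure at some $x\in X$. **Theorem.** Let $(b,c)$ be transient with $\partial_hX\neq\emptyset$ and let $\mu$ be a harmonic measure. Then for every $o\in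 X$: 1. there is a constant $C_o\ge0$ such that for all $f\in\widetilde D\cap\ell^\infty(X)$ $$\int_{\partial_hX}(\gamma_0f)^2\,d\mu\le C_o\|f\|_o^2;$$ 2. there is a unique continuous linear operator $\operatorname{Tr}:(\widetilde D,\|\cdot\|_o)\to L^2(\partial_hX,\mu)$ with $\operatorname{Tr}f=\gamma_0f$ $\mu$-almost everywhere for all $f\in\widetilde D\cap\ell^\infty(X)$. -/

import Mathlib

open MeasureTheory
open scoped ENNReal

/-- A connected weighted graph `(b, c)` over `X`. -/
structure WeightedGraph (X : Type*) where
  b : X → X → ℝ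
  c : X → ℝ
  b_nonneg : ∀ x y, 0 ≤ b x y
  c_nonneg : ∀ x, 0 ≤ c x
  b_symm : ∀ x y, b x y = b y x
  b_diag : ∀ x, b x x = 0
  b_summable : ∀ x, Summable (b x)
  connected : ∀ x y, Relation.ReflTransGen (fun u v => 0 < b u v) x y

namespace WeightedGraph

noncomputable section

variable {X : Type*} (G : WeightedGraph X)

/-- The energy form `Q̃ : C(X) → [0, ∞]`. -/
def energy (f : X → ℝ) : ℝ≥0∞ :=
  2⁻¹ * ∑' p : X × X, ENNReal.ofReal (G.b p.1 p.2 * (f p.1 - f p.2) ^ 2)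
    + ∑' x, ENNReal.ofReal (G.c x * f x ^ 2)

/-- `h` lies in the domain of the formal Laplacian and the formal Laplacian of `h` vanishes. -/
def IsHarmonic (h : X → ℝ) : Prop :=
  (∀ x, Summable fun y => G.b x y * |h y|) ∧
    ∀ x, ∑' y, G.b x y * (h x - h y) + G.c x * h x = 0

theorem energy_lt_top_iff (f : X → ℝ) :
    G.energy f < ∞ ↔ (Summable fun p : X × X => G.b p.1 p.2 * (f p.1 - f p.2) ^ 2) ∧
      Summable fun x => G.c x * f x ^ 2 := by
  have key : ∀ {ι : Type _} (g : ι → ℝ), (∀ i, 0 ≤ g i) →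
      (∑' i, ENNReal.ofReal (g i) < ∞ ↔ Summable g) := by
    intro ι g hg
    refine ⟨fun h => ?_, fun h => h.tsum_ofReal_lt_top⟩
    have := ENNReal.summable_toReal h.ne
    simpa [ENNReal.toReal_ofReal, hg] using this
  have hb : ∀ p : X × X, 0 ≤ G.b p.1 p.2 * (f p.1 - f p.2) ^ 2 :=
    fun p => mul_nonneg (G.b_nonneg _ _) (sq_nonneg _)
  have hc : ∀ x, 0 ≤ G.c x * f x ^ 2 := fun x => mul_nonneg (G.c_nonneg _) (sq_nonneg _)
  rw [← key _ hc]
  have : (Summable fun p : X × X => G.b p.1 p.2 * (f p.1 - f p.2) ^ 2) ↔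
      ∑' p : X × X, ENNReal.ofReal (G.b p.1 p.2 * (f p.1 - f p.2) ^ 2) < ∞ := by
    refine ⟨fun h => h.tsum_ofReal_lt_top, fun h => ?_⟩
    have := ENNReal.summable_toReal h.ne
    simpa [ENNReal.toReal_ofReal, hb] using this
  rw [this, energy, ENNReal.add_lt_top, ENNReal.mul_lt_top_iff]
  constructor
  · rintro ⟨h | h | h, h'⟩
    · exact ⟨h.2, h'⟩
    · simp at h
    · exact ⟨by simp [h], h'⟩
  · exact fun h => ⟨Or.inl ⟨by simp, h.1⟩, h.2⟩

/-- The space `D̃` of functions of finite energy. -/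
def finiteEnergy : Submodule ℝ (X → ℝ) where
  carrier := {f | G.energy f < ∞}
  zero_mem' := by simp [energy]
  add_mem' := by
    intro f g hf hg
    rw [Set.mem_ofPred_eq, energy_lt_top_iff] at *
    refine ⟨Summable.of_nonneg_of_le
        (fun p => mul_nonneg (G.b_nonneg _ _) (sq_nonneg _)) (fun p => ?_)
        ((hf.1.mul_left 2).add (hg.1.mul_left 2)),
      Summable.of_nonneg_of_le
        (fun p => mul_nonneg (G.c_nonneg _) (sq_nonneg _)) (fun p => ?_)
        ((hf.2.mul_left 2).add (hg.2.mul_left 2))⟩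
    · have := mul_nonneg (G.b_nonneg p.1 p.2) (sq_nonneg ((f p.1 - f p.2) - (g p.1 - g p.2)))
      simp only [Pi.add_apply]
      nlinarith
    · have := mul_nonneg (G.c_nonneg p) (sq_nonneg (f p - g p))
      simp only [Pi.add_apply]
      nlinarith
  smul_mem' := by
    intro r f hf
    rw [Set.mem_ofPred_eq, energy_lt_top_iff] at *
    refine ⟨(hf.1.mul_left (r ^ 2)).congr fun p => ?_, (hf.2.mul_left (r ^ 2)).congr fun p => ?_⟩
    · simp only [Pi.smul_apply, smul_eq_mul]; ring
    · simp only [Pi.smul_apply, smul_eq_mul]; ring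

/-- The polarization of the energy form. -/
def energyInner (f g : X → ℝ) : ℝ :=
  2⁻¹ * ∑' p : X × X, G.b p.1 p.2 * (f p.1 - f p.2) * (g p.1 - g p.2)
    + ∑' x, G.c x * f x * g x

theorem summable_b_mul {f g : X → ℝ} (hf : f ∈ G.finiteEnergy) (hg : g ∈ G.finiteEnergy) :
    Summable fun p : X × X => G.b p.1 p.2 * (f p.1 - f p.2) * (g p.1 - g p.2) := by
  have hf' := (G.energy_lt_top_iff f).1 hf
  have hg' := (G.energy_lt_top_iff g).1 hg
  refine Summable.of_norm_bounded (hf'.1.add hg'.1) fun p => ?_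
  have h1 := mul_nonneg (G.b_nonneg p.1 p.2) (sq_nonneg ((f p.1 - f p.2) - (g p.1 - g p.2)))
  have h2 := mul_nonneg (G.b_nonneg p.1 p.2) (sq_nonneg ((f p.1 - f p.2) + (g p.1 - g p.2)))
  have h3 := mul_nonneg (G.b_nonneg p.1 p.2) (sq_nonneg (f p.1 - f p.2))
  have h4 := mul_nonneg (G.b_nonneg p.1 p.2) (sq_nonneg (g p.1 - g p.2))
  rw [Real.norm_eq_abs, abs_le]
  constructor <;> nlinarith

theorem summable_c_mul {f g : X → ℝ} (hf : f ∈ G.finiteEnergy) (hg : g ∈ G.finiteEnergy) :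
    Summable fun x => G.c x * f x * g x := by
  have hf' := (G.energy_lt_top_iff f).1 hf
  have hg' := (G.energy_lt_top_iff g).1 hg
  refine Summable.of_norm_bounded (hf'.2.add hg'.2) fun p => ?_
  have h1 := mul_nonneg (G.c_nonneg p) (sq_nonneg (f p - g p))
  have h2 := mul_nonneg (G.c_nonneg p) (sq_nonneg (f p + g p))
  have h3 := mul_nonneg (G.c_nonneg p) (sq_nonneg (f p))
  have h4 := mul_nonneg (G.c_nonneg p) (sq_nonneg (g p))
  rw [Real.norm_eq_abs, abs_le]
  constructor <;> nlinarith

theorem energyInner_self {f : X → ℝ} (hf : f ∈ G.finiteEnergy) :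
    G.energyInner f f = (G.energy f).toReal := by
  have hf' := (G.energy_lt_top_iff f).1 hf
  rw [energy, energyInner, ENNReal.toReal_add, ENNReal.toReal_mul,
    ← ENNReal.ofReal_tsum_of_nonneg
      (fun p => mul_nonneg (G.b_nonneg _ _) (sq_nonneg _)) hf'.1,
    ← ENNReal.ofReal_tsum_of_nonneg
      (fun p => mul_nonneg (G.c_nonneg _) (sq_nonneg _)) hf'.2,
    ENNReal.toReal_ofReal
      (tsum_nonneg fun p => mul_nonneg (G.b_nonneg _ _) (sq_nonneg _)),
    ENNReal.toReal_ofReal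
      (tsum_nonneg fun p => mul_nonneg (G.c_nonneg _) (sq_nonneg _))]
  · simp [pow_two, mul_assoc]
  · exact ENNReal.mul_ne_top (by simp) hf'.1.tsum_ofReal_ne_top
  · exact hf'.2.tsum_ofReal_ne_top

theorem eq_zero_of_energyInner {f : X → ℝ} (hf : f ∈ G.finiteEnergy) (o : X)
    (h0 : G.energyInner f f + f o * f o = 0) : f = 0 := by
  have hf' := (G.energy_lt_top_iff f).1 hf
  have hnb : ∀ p : X × X, 0 ≤ G.b p.1 p.2 * (f p.1 - f p.2) * (f p.1 - f p.2) := fun p => by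
    rw [mul_assoc]; exact mul_nonneg (G.b_nonneg _ _) (mul_self_nonneg _)
  have hnc : ∀ x, 0 ≤ G.c x * f x * f x := fun x => by
    rw [mul_assoc]; exact mul_nonneg (G.c_nonneg _) (mul_self_nonneg _)
  have h1 : 0 ≤ ∑' p : X × X, G.b p.1 p.2 * (f p.1 - f p.2) * (f p.1 - f p.2) := tsum_nonneg hnb
  have h2 : 0 ≤ ∑' x, G.c x * f x * f x := tsum_nonneg hnc
  have h3 := mul_self_nonneg (f o)
  rw [energyInner] at h0
  have hB : ∑' p : X × X, G.b p.1 p.2 * (f p.1 - f p.2) * (f p.1 - f p.2) = 0 := by linarith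
  have ho : f o = 0 := mul_self_eq_zero.1 (by linarith)
  have hz := (hasSum_zero_iff_of_nonneg hnb).1 (hB ▸ (G.summable_b_mul hf hf).hasSum)
  funext x
  have := G.connected o x
  induction this with
  | refl => exact ho
  | @tail u v _ huv ih =>
    have h := congrFun hz (u, v)
    simp only [Pi.zero_apply, mul_eq_zero, huv.ne', false_or, or_self] at h
    simp only [Pi.zero_apply] at ih ⊢
    linarith

/-- The space `D̃`, to be equipped with the inner product
`⟨f, g⟩_o = Q̃(f, g) + f(o) g(o)`. -/
def EnergySpace (_o : X) : Type _ := G.finiteEnergy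

namespace EnergySpace

variable {G} {o : X}

instance : AddCommGroup (G.EnergySpace o) := inferInstanceAs (AddCommGroup G.finiteEnergy)

instance : Module ℝ (G.EnergySpace o) := inferInstanceAs (Module ℝ G.finiteEnergy)

/-- An element of `D̃` as a function on `X`. -/
def fn (f : G.EnergySpace o) : X → ℝ := f.1

variable (G o) in
/-- The inner product `⟨f, g⟩_o = Q̃(f, g) + f(o) g(o)` on `D̃`. -/
@[reducible]
def core : InnerProductSpace.Core ℝ (G.EnergySpace o) where
  inner f g := G.energyInner f.fn g.fn + f.fn o * g.fn o
  conj_inner_symm f g := by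
    simp only [energyInner, conj_trivial, mul_assoc]
    simp only [mul_comm]
  re_inner_nonneg f := by
    have h : G.energyInner f.fn f.fn = _ := G.energyInner_self f.2
    simp only [h, RCLike.re_to_real]
    exact add_nonneg ENNReal.toReal_nonneg (mul_self_nonneg _)
  add_left f g h := by
    have e : (f + g).fn = f.fn + g.fn := rfl
    simp only [e, energyInner, Pi.add_apply]
    have h1 : ∀ p : X × X, G.b p.1 p.2 * (f.fn p.1 + g.fn p.1 - (f.fn p.2 + g.fn p.2)) *
        (h.fn p.1 - h.fn p.2) = G.b p.1 p.2 * (f.fn p.1 - f.fn p.2) * (h.fn p.1 - h.fn p.2) +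
          G.b p.1 p.2 * (g.fn p.1 - g.fn p.2) * (h.fn p.1 - h.fn p.2) := fun p => by ring
    have h2 : ∀ x, G.c x * (f.fn x + g.fn x) * h.fn x =
        G.c x * f.fn x * h.fn x + G.c x * g.fn x * h.fn x := fun x => by ring
    simp only [h1, h2]
    have hf : f.fn ∈ G.finiteEnergy := f.2
    have hg : g.fn ∈ G.finiteEnergy := g.2
    have hh : h.fn ∈ G.finiteEnergy := h.2
    rw [(G.summable_b_mul hf hh).tsum_add (G.summable_b_mul hg hh),
      (G.summable_c_mul hf hh).tsum_add (G.summable_c_mul hg hh)]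
    ring
  smul_left f g r := by
    have e : (r • f).fn = r • f.fn := rfl
    simp only [e, energyInner, Pi.smul_apply, smul_eq_mul, conj_trivial]
    have h1 : ∀ p : X × X, G.b p.1 p.2 * (r * f.fn p.1 - r * f.fn p.2) * (g.fn p.1 - g.fn p.2) =
        r * (G.b p.1 p.2 * (f.fn p.1 - f.fn p.2) * (g.fn p.1 - g.fn p.2)) := fun p => by ring
    have h2 : ∀ x, G.c x * (r * f.fn x) * g.fn x = r * (G.c x * f.fn x * g.fn x) :=
      fun x => by ring
    simp only [h1, h2, tsum_mul_left]
    ring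
  definite f hf := Subtype.ext (G.eq_zero_of_energyInner f.2 o hf)

instance : NormedAddCommGroup (G.EnergySpace o) := (core G o).toNormedAddCommGroup

instance : InnerProductSpace ℝ (G.EnergySpace o) := InnerProductSpace.ofCore (core G o).toCore

theorem norm_sq (f : G.EnergySpace o) :
    ‖f‖ ^ 2 = (G.energy f.fn).toReal + f.fn o ^ 2 := by
  have h : G.energyInner f.fn f.fn = _ := G.energyInner_self f.2
  rw [← real_inner_self_eq_norm_sq, pow_two, ← h]
  rfl

end EnergySpace

/-- The `‖·‖_o`-closure `D₀` in `D̃` of the finitely supported functions. The closure is the same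
for all base points `o`. -/
def D0 : Set (X → ℝ) :=
  {f | ∃ hf : f ∈ G.finiteEnergy, ∀ o : X,
    (⟨f, hf⟩ : G.EnergySpace o) ∈ closure {φ : G.EnergySpace o | φ.fn.support.Finite}}

/-- The graph is transient. -/
def IsTransient : Prop := ∀ f ∈ G.D0, G.energy f = 0 → f = 0

/-- The space `D̃ ∩ ℓ^∞(X)` of bounded functions of finite energy. -/
def bddFiniteEnergy : Submodule ℝ (lp (fun _ : X => ℝ) ∞) where
  carrier := {f | (f : X → ℝ) ∈ G.finiteEnergy}
  zero_mem' := G.finiteEnergy.zero_mem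
  add_mem' := fun hf hg => G.finiteEnergy.add_mem hf hg
  smul_mem' := fun r _ hf => G.finiteEnergy.smul_mem r hf

/-- The Royden algebra `A`: the uniform closure of `D̃ ∩ ℓ^∞(X)` in `ℓ^∞(X)`. -/
def roydenAlgebra : Submodule ℝ (lp (fun _ : X => ℝ) ∞) := G.bddFiniteEnergy.topologicalClosure

/-- The algebra `A⁺` generated by the Royden algebra and the constant function `1`. -/
def roydenAlgebraPlus : Subalgebra ℝ (lp (fun _ : X => ℝ) ∞) :=
  Algebra.adjoin ℝ (G.roydenAlgebra : Set (lp (fun _ : X => ℝ) ∞))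

/-- The Royden compactification `R`: the Gelfand spectrum of `A⁺`. A function `f` in `A⁺` is
identified with the continuous function `z ↦ z f` on `R`. -/
abbrev RoydenCompactification : Type _ := WeakDual.characterSpace ℝ G.roydenAlgebraPlus

/-- A vertex `x`, seen as the point of `R` given by the evaluation at `x`. -/
def IsVertex (z : G.RoydenCompactification) (x : X) : Prop :=
  ∀ f : G.roydenAlgebraPlus, z f = (f : lp (fun _ : X => ℝ) ∞) x

/-- The Royden boundary `∂X = R \ X`. -/
def roydenBoundary : Set G.RoydenCompactification := {z | ∀ x, ¬ G.IsVertex z x}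

/-- The harmonic boundary `∂_h X`: the points of the Royden boundary at which all functions in
`D₀ ∩ ℓ^∞(X)` vanish. -/
def harmonicBoundary : Set G.RoydenCompactification :=
  {z ∈ G.roydenBoundary | ∀ f : G.roydenAlgebraPlus,
    ((f : lp (fun _ : X => ℝ) ∞) : X → ℝ) ∈ G.D0 → z f = 0}

instance : MeasurableSpace G.harmonicBoundary := borel _

instance : BorelSpace G.harmonicBoundary := ⟨rfl⟩

/-- The preliminary trace map `γ₀ : A → C(∂_h X)`, the restriction to the harmonic boundary of the
continuous extension to `R`. -/
def preTrace (f : G.roydenAlgebra) : C(G.harmonicBoundary, ℝ) where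
  toFun z := z.1 ⟨f, Algebra.subset_adjoin f.2⟩
  continuous_toFun := by
    exact (WeakDual.eval_continuous _).comp (continuous_subtype_val.comp continuous_subtype_val)

/-- The inclusion of `D̃ ∩ ℓ^∞(X)` in the Royden algebra. -/
def toRoyden (f : G.bddFiniteEnergy) : G.roydenAlgebra :=
  ⟨f, G.bddFiniteEnergy.le_topologicalClosure f.2⟩

/-- The inclusion of `D̃ ∩ ℓ^∞(X)` in `D̃`. -/
def toEnergySpace (o : X) (f : G.bddFiniteEnergy) : G.EnergySpace o := ⟨f.1, f.2⟩

/-- `μ` is the harmonic measure at `x`: a regular Borel measure on `∂_h X` of total mass at most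
`1` that represents the values at `x` of the bounded harmonic functions of finite energy and does
not charge a point at which the whole Royden algebra vanishes. There is at most one such point,
and there is none if `1` belongs to the Royden algebra. -/
structure IsHarmonicMeasureAt (x : X) (μ : Measure G.harmonicBoundary) : Prop where
  regular : μ.Regular
  mass_le_one : μ Set.univ ≤ 1
  repr : ∀ h : G.bddFiniteEnergy, G.IsHarmonic (h : lp (fun _ : X => ℝ) ∞) →
    (h : lp (fun _ : X => ℝ) ∞) x = ∫ z, G.preTrace (G.toRoyden h) z ∂μ
  null : ∀ p : G.harmonicBoundary, (∀ f : G.roydenAlgebra, G.preTrace f p = 0) → μ {p} = 0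

/-- `μ` is a harmonic measure. -/
def IsHarmonicMeasure (μ : Measure G.harmonicBoundary) : Prop :=
  ∃ x, G.IsHarmonicMeasureAt x μ

end

end WeightedGraph

/-!
The trace inequality rests on the Royden decomposition. On a transient graph the energy form `Q̃` is
coercive on `D₀` (`exists_sq_base_le_form`): otherwise functions in `D₀` with value `1` at the base
point and energies tending to `0` would converge to the constant function `1`, a nonzero element of
`D₀` without energy. By the Lax-Milgram theorem every bounded functional on `D₀` is represented by
`Q̃` (`exists_form_eq`). This yields the Green functions, which represent the point evaluations, and
the decomposition `f = f₀ + u` with `f₀ ∈ D₀` and `u` orthogonal to `D₀`, hence harmonic. If `f` is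
bounded, truncation shows that `u` has the same bound (`exists_royden_decomposition`).

For a bounded `f` the functions `f` and `u` have the same trace, because `D₀ ∩ ℓ^∞(X)` vanishes on
the harmonic boundary. The decomposition `u² = w₀ + h` of the square shows in the same way that
`(γ₀ f)² = γ₀ h`, where `h` is a bounded harmonic function of finite energy. If `μ` is a harmonic
measure at `x`, then `∫ (γ₀ f)² dμ = h(x) = u(x)² - w₀(x)`, and it remains to bound `h(x)` by the
energy. With the Green function `g` at `x`, `w₀(x) = Q̃(g, w₀) = Q̃(g, u²)`. Approximate `g` by
finitely supported functions `ψ` with a common upper bound `C` (`exists_green_approx`). The product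
rule gives
`2 Q̃(ψu, u) - Q̃(ψ, u²) = ½ ∑ b(y,z) (ψ(y) + ψ(z)) (u(y) - u(z))² + ∑ c(y) ψ(y) u(y)² ≤ 2C Q̃(u)`,
and `Q̃(ψu, u) = 0` because `ψu` is finitely supported and `u` is orthogonal to `D₀`. Hence
`h(x) ≤ u(x)² + 2C Q̃(u)` (`exists_harmonic_majorant`).

The trace operator is the extension by continuity of `γ₀` from the bounded functions, which are dense
in `D̃` by truncation (`tendsto_trunc`).
-/

namespace WeightedGraph

noncomputable section

open Filter Topology

variable {X : Type*} (G : WeightedGraph X)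

/-! ### The energy form -/

theorem lowerSemicontinuous_energy : LowerSemicontinuous G.energy := by
  have h : G.energy = fun f => (∑' p : X × X,
      2⁻¹ * ENNReal.ofReal (G.b p.1 p.2 * (f p.1 - f p.2) ^ 2))
      + ∑' x, ENNReal.ofReal (G.c x * f x ^ 2) := by
    funext f
    rw [energy, ENNReal.tsum_mul_left]
  rw [h]
  refine LowerSemicontinuous.add
    (lowerSemicontinuous_tsum fun p => Continuous.lowerSemicontinuous ?_)
    (lowerSemicontinuous_tsum fun x => Continuous.lowerSemicontinuous ?_)
  · exact (ENNReal.continuous_const_mul (by simp)).comp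
      (ENNReal.continuous_ofReal.comp (by fun_prop))
  · exact ENNReal.continuous_ofReal.comp (by fun_prop)

theorem energy_mono {f g : X → ℝ} (h₁ : ∀ x y, |g x - g y| ≤ |f x - f y|)
    (h₂ : ∀ x, |g x| ≤ |f x|) : G.energy g ≤ G.energy f := by
  refine add_le_add (mul_le_mul_right (ENNReal.tsum_le_tsum fun p => ?_) _)
    (ENNReal.tsum_le_tsum fun x => ?_)
  · exact ENNReal.ofReal_le_ofReal
      (mul_le_mul_of_nonneg_left (sq_le_sq.2 (h₁ _ _)) (G.b_nonneg _ _))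
  · exact ENNReal.ofReal_le_ofReal
      (mul_le_mul_of_nonneg_left (sq_le_sq.2 (h₂ _)) (G.c_nonneg _))

theorem energyInner_self_mono {f g : X → ℝ} (hf : f ∈ G.finiteEnergy)
    (h₁ : ∀ x y, |g x - g y| ≤ |f x - f y|) (h₂ : ∀ x, |g x| ≤ |f x|) :
    g ∈ G.finiteEnergy ∧ G.energyInner g g ≤ G.energyInner f f := by
  have hle := G.energy_mono h₁ h₂
  have hg : g ∈ G.finiteEnergy := hle.trans_lt hf
  refine ⟨hg, ?_⟩
  rw [G.energyInner_self hg, G.energyInner_self hf]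
  exact ENNReal.toReal_mono (ne_of_lt hf) hle

theorem energyInner_self_nonneg {f : X → ℝ} (hf : f ∈ G.finiteEnergy) :
    0 ≤ G.energyInner f f := by
  rw [G.energyInner_self hf]; positivity

theorem b_mul_sq_le {f : X → ℝ} (hf : f ∈ G.finiteEnergy) (x y : X) :
    G.b x y * (f x - f y) ^ 2 ≤ 2 * G.energyInner f f := by
  have h1 : ∀ p : X × X, 0 ≤ G.b p.1 p.2 * (f p.1 - f p.2) * (f p.1 - f p.2) := fun p => by
    rw [mul_assoc]; exact mul_nonneg (G.b_nonneg _ _) (mul_self_nonneg _)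
  have h2 : ∀ x, 0 ≤ G.c x * f x * f x := fun x => by
    rw [mul_assoc]; exact mul_nonneg (G.c_nonneg _) (mul_self_nonneg _)
  have h3 := (G.summable_b_mul hf hf).le_tsum (x, y) (fun p _ => h1 p)
  have h4 : 0 ≤ ∑' x, G.c x * f x * f x := tsum_nonneg h2
  simp only [energyInner] at h3 ⊢
  nlinarith

theorem c_mul_sq_le {f : X → ℝ} (hf : f ∈ G.finiteEnergy) (x : X) :
    G.c x * f x ^ 2 ≤ G.energyInner f f := by
  have h1 : ∀ p : X × X, 0 ≤ G.b p.1 p.2 * (f p.1 - f p.2) * (f p.1 - f p.2) := fun p => by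
    rw [mul_assoc]; exact mul_nonneg (G.b_nonneg _ _) (mul_self_nonneg _)
  have h2 : ∀ x, 0 ≤ G.c x * f x * f x := fun x => by
    rw [mul_assoc]; exact mul_nonneg (G.c_nonneg _) (mul_self_nonneg _)
  have h3 := (G.summable_c_mul hf hf).le_tsum x (fun p _ => h2 p)
  have h4 : 0 ≤ ∑' p : X × X, G.b p.1 p.2 * (f p.1 - f p.2) * (f p.1 - f p.2) := tsum_nonneg h1
  simp only [energyInner]
  nlinarith

/-- Summing the energy along a path controls the oscillation between its endpoints. -/
theorem exists_sq_sub_le (x y : X) : ∃ C : ℝ, 0 ≤ C ∧ ∀ f ∈ G.finiteEnergy,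
    (f x - f y) ^ 2 ≤ C * G.energyInner f f := by
  induction G.connected x y with
  | refl => exact ⟨0, le_rfl, fun f hf => by simp⟩
  | @tail u v _ huv ih =>
    obtain ⟨C, hC, h⟩ := ih
    refine ⟨2 * C + 2 * (2 / G.b u v), by positivity, fun f hf => ?_⟩
    have h1 := h f hf
    have h2 : (f u - f v) ^ 2 ≤ 2 / G.b u v * G.energyInner f f := by
      rw [div_mul_eq_mul_div, le_div_iff₀ huv, mul_comm]
      exact G.b_mul_sq_le hf u v
    nlinarith [sq_nonneg ((f x - f u) - (f u - f v))]

/-- A finitely supported function has finite energy because the weights at a vertex are summable. -/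
theorem mem_finiteEnergy_of_finite_support {f : X → ℝ} (hf : f.support.Finite) :
    f ∈ G.finiteEnergy := by
  refine (G.energy_lt_top_iff f).2 ⟨?_, ?_⟩
  · have h1 : Summable fun p : X × X => G.b p.1 p.2 * f p.1 ^ 2 := by
      have h0 : 0 ≤ fun p : X × X => G.b p.1 p.2 * f p.1 ^ 2 :=
        fun p => mul_nonneg (G.b_nonneg _ _) (sq_nonneg _)
      refine (summable_prod_of_nonneg h0).2 ⟨fun x => (G.b_summable x).mul_right (f x ^ 2), ?_⟩
      refine summable_of_hasFiniteSupport (hf.subset fun x hx => ?_)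
      contrapose! hx
      simp only [Function.notMem_support] at hx ⊢
      simp [hx]
    have h2 : Summable fun p : X × X => G.b p.1 p.2 * f p.2 ^ 2 := by
      refine ((Equiv.prodComm X X).summable_iff.2 h1).congr fun p => ?_
      simp [G.b_symm p.1 p.2]
    refine Summable.of_nonneg_of_le (fun p => mul_nonneg (G.b_nonneg _ _) (sq_nonneg _))
      (fun p => ?_) ((h1.mul_left 2).add (h2.mul_left 2))
    nlinarith [mul_nonneg (G.b_nonneg p.1 p.2) (sq_nonneg (f p.1 + f p.2))]
  · refine summable_of_hasFiniteSupport (hf.subset fun x hx => ?_)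
    contrapose! hx
    simp only [Function.notMem_support] at hx ⊢
    simp [hx]

/-! ### The Hilbert space of functions of finite energy -/

namespace EnergySpace

variable {G} {o : X}

theorem fn_mem (f : G.EnergySpace o) : f.fn ∈ G.finiteEnergy := f.2

/-- A function of finite energy as an element of the normed space `D̃`. -/
def mk (f : X → ℝ) (hf : f ∈ G.finiteEnergy) : G.EnergySpace o := ⟨f, hf⟩

@[simp] theorem fn_mk (f : X → ℝ) (hf : f ∈ G.finiteEnergy) :
    (mk f hf : G.EnergySpace o).fn = f := rfl

@[simp] theorem fn_add (f g : G.EnergySpace o) : (f + g).fn = f.fn + g.fn := rfl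

@[simp] theorem fn_sub (f g : G.EnergySpace o) : (f - g).fn = f.fn - g.fn := rfl

@[simp] theorem fn_smul (r : ℝ) (f : G.EnergySpace o) : (r • f).fn = r • f.fn := rfl

@[simp] theorem fn_zero : (0 : G.EnergySpace o).fn = 0 := rfl

theorem fn_injective : Function.Injective (fn : G.EnergySpace o → X → ℝ) :=
  Subtype.val_injective

theorem norm_sq_eq (f : G.EnergySpace o) :
    ‖f‖ ^ 2 = G.energyInner f.fn f.fn + f.fn o ^ 2 := by
  rw [norm_sq, G.energyInner_self f.fn_mem]

theorem energyInner_self_le (f : G.EnergySpace o) : G.energyInner f.fn f.fn ≤ ‖f‖ ^ 2 := by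
  rw [norm_sq_eq]; nlinarith [sq_nonneg (f.fn o)]

theorem exists_sq_apply_le (o x : X) : ∃ C : ℝ, 0 ≤ C ∧ ∀ f : G.EnergySpace o,
    f.fn x ^ 2 ≤ C * ‖f‖ ^ 2 := by
  obtain ⟨C, hC, h⟩ := G.exists_sq_sub_le x o
  refine ⟨2 * C + 2, by positivity, fun f => ?_⟩
  have h1 := h f.fn f.fn_mem
  have h2 := G.energyInner_self_nonneg f.fn_mem
  rw [norm_sq_eq]
  nlinarith [sq_nonneg ((f.fn x - f.fn o) - f.fn o), mul_nonneg hC (sq_nonneg (f.fn o))]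

variable (G o) in
/-- The evaluation at a vertex, a continuous linear functional on `D̃`. -/
def evalCLM (x : X) : G.EnergySpace o →L[ℝ] ℝ :=
  LinearMap.mkContinuousOfExistsBound
    { toFun := fun f => f.fn x
      map_add' := fun _ _ => rfl
      map_smul' := fun _ _ => rfl } <| by
    obtain ⟨C, hC, h⟩ := exists_sq_apply_le (G := G) o x
    refine ⟨√C, fun f => ?_⟩
    refine abs_le_of_sq_le_sq ?_ (by positivity)
    rw [mul_pow, Real.sq_sqrt hC]
    exact h f

@[simp] theorem evalCLM_apply (x : X) (f : G.EnergySpace o) : evalCLM G o x f = f.fn x := rfl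

variable (G o) in
/-- The energy form as a continuous bilinear form on `D̃`. -/
def form : G.EnergySpace o →L[ℝ] G.EnergySpace o →L[ℝ] ℝ :=
  (isBoundedBilinearMap_inner (𝕜 := ℝ) (E := G.EnergySpace o)).toContinuousLinearMap -
    (evalCLM G o o).smulRight (evalCLM G o o)

theorem form_apply (f g : G.EnergySpace o) : form G o f g = G.energyInner f.fn g.fn := by
  have h : inner ℝ f g = G.energyInner f.fn g.fn + f.fn o * g.fn o := rfl
  simp [form, h]

theorem form_comm (f g : G.EnergySpace o) : form G o f g = form G o g f := by
  simp only [form_apply, energyInner, mul_assoc]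
  simp only [mul_comm]

theorem form_self_nonneg (f : G.EnergySpace o) : 0 ≤ form G o f f := by
  rw [form_apply]; exact G.energyInner_self_nonneg f.fn_mem

theorem norm_sq_eq_form (f : G.EnergySpace o) : ‖f‖ ^ 2 = form G o f f + f.fn o ^ 2 := by
  rw [norm_sq_eq, form_apply]

theorem form_self_sub (f g : G.EnergySpace o) :
    form G o (f - g) (f - g) = form G o f f - 2 * form G o f g + form G o g g := by
  simp only [map_sub, sub_apply, form_comm g f]
  ring

theorem form_self_add (f g : G.EnergySpace o) :
    form G o (f + g) (f + g) = form G o f f + 2 * form G o f g + form G o g g := by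
  simp only [map_add, add_apply, form_comm g f]
  ring

/-- Convergence in `D̃` is convergence at the base point together with convergence in energy. -/
theorem tendsto_iff {ι : Type*} {l : Filter ι} {u : ι → G.EnergySpace o} {f : G.EnergySpace o}
    (h₁ : Tendsto (fun i => form G o (u i - f) (u i - f)) l (𝓝 0))
    (h₂ : Tendsto (fun i => (u i).fn o) l (𝓝 (f.fn o))) : Tendsto u l (𝓝 f) := by
  rw [tendsto_iff_norm_sub_tendsto_zero]
  have h3 : Tendsto (fun i => ‖u i - f‖ ^ 2) l (𝓝 0) := by
    have h4 : Tendsto (fun i => ((u i).fn o - f.fn o) ^ 2) l (𝓝 0) := by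
      simpa using (h₂.sub_const (f.fn o)).pow 2
    simpa [norm_sq_eq_form] using h₁.add h4
  simpa using h3.sqrt

theorem tendsto_apply {ι : Type*} {l : Filter ι} {u : ι → G.EnergySpace o} {f : G.EnergySpace o}
    (h : Tendsto u l (𝓝 f)) (x : X) : Tendsto (fun i => (u i).fn x) l (𝓝 (f.fn x)) :=
  ((evalCLM G o x).continuous.tendsto f).comp h

theorem energy_le_ofReal (f : G.EnergySpace o) : G.energy f.fn ≤ ENNReal.ofReal (‖f‖ ^ 2) := by
  rw [ENNReal.le_ofReal_iff_toReal_le (ne_of_lt f.fn_mem) (by positivity),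
    ← G.energyInner_self f.fn_mem]
  exact energyInner_self_le f

/-- A Cauchy sequence converges pointwise, and the energy is lower semicontinuous under pointwise
convergence. -/
instance : CompleteSpace (G.EnergySpace o) := by
  refine Metric.complete_of_cauchySeq_tendsto fun u hu => ?_
  have h1 : ∀ x, ∃ a, Tendsto (fun n => (u n).fn x) atTop (𝓝 a) := fun x =>
    cauchySeq_tendsto_of_complete (hu.map (evalCLM G o x).uniformContinuous)
  choose f hf using h1
  have key : ∀ ε > 0, ∃ N, ∀ n ≥ N, G.energy ((u n).fn - f) ≤ ENNReal.ofReal (ε ^ 2) := by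
    intro ε hε
    obtain ⟨N, hN⟩ := Metric.cauchySeq_iff.1 hu ε hε
    refine ⟨N, fun n hn => ?_⟩
    have hc := G.lowerSemicontinuous_energy.isClosed_preimage (ENNReal.ofReal (ε ^ 2))
    have ht : Tendsto (fun m => (u n - u m).fn) atTop (𝓝 ((u n).fn - f)) :=
      tendsto_pi_nhds.2 fun x => (hf x).const_sub _
    refine hc.mem_of_tendsto ht (eventually_atTop.2 ⟨N, fun m hm => ?_⟩)
    refine (energy_le_ofReal (u n - u m)).trans (ENNReal.ofReal_le_ofReal ?_)
    have := hN n hn m hm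
    rw [dist_eq_norm] at this
    gcongr
  have hfe : f ∈ G.finiteEnergy := by
    obtain ⟨N, hN⟩ := key 1 one_pos
    have h2 : (u N).fn - f ∈ G.finiteEnergy := (hN N le_rfl).trans_lt ENNReal.ofReal_lt_top
    simpa using G.finiteEnergy.sub_mem (u N).fn_mem h2
  refine ⟨mk f hfe, tendsto_iff ?_ (hf o)⟩
  rw [Metric.tendsto_atTop]
  intro ε hε
  obtain ⟨N, hN⟩ := key (√(ε / 2)) (by positivity)
  refine ⟨N, fun n hn => ?_⟩
  have h3 := hN n hn
  have h4 : form G o (u n - mk f hfe) (u n - mk f hfe) ≤ ε / 2 := by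
    rw [form_apply, G.energyInner_self (fn_mem _)]
    refine ENNReal.toReal_le_of_le_ofReal (by positivity) ?_
    rwa [Real.sq_sqrt (by positivity)] at h3
  rw [Real.dist_eq, sub_zero, abs_of_nonneg (form_self_nonneg _)]
  linarith

/-! ### The space `D₀` of a transient graph -/

theorem tendsto_form_self {ι : Type*} {l : Filter ι} {u : ι → G.EnergySpace o}
    {f : G.EnergySpace o} (h : Tendsto u l (𝓝 f)) :
    Tendsto (fun i => form G o (u i) (u i)) l (𝓝 (form G o f f)) := by
  have h1 : ∀ g : G.EnergySpace o, form G o g g = ‖g‖ ^ 2 - g.fn o ^ 2 := fun g => by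
    rw [norm_sq_eq_form]; ring
  simp only [h1]
  exact (h.norm.pow 2).sub ((tendsto_apply h o).pow 2)

variable (G o) in
/-- The finitely supported functions, as a subspace of `D̃`. -/
def finiteSupport : Submodule ℝ (G.EnergySpace o) where
  carrier := {φ | φ.fn.support.Finite}
  zero_mem' := by simp
  add_mem' := fun {f g} hf hg => (hf.union hg).subset (Function.support_add f.fn g.fn)
  smul_mem' := fun r f hf => hf.subset (Function.support_const_smul_subset r f.fn)

variable (G o) in
/-- The closure `D₀` of the finitely supported functions, as a subspace of `D̃`. -/
def closedD0 : Submodule ℝ (G.EnergySpace o) := (finiteSupport G o).topologicalClosure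

theorem mem_closedD0_iff_seq {u : G.EnergySpace o} : u ∈ closedD0 G o ↔
    ∃ φ : ℕ → G.EnergySpace o, (∀ n, φ n ∈ finiteSupport G o) ∧ Tendsto φ atTop (𝓝 u) :=
  mem_closure_iff_seq_limit

theorem mem_closedD0_of_finite {φ : G.EnergySpace o} (h : φ.fn.support.Finite) :
    φ ∈ closedD0 G o :=
  (finiteSupport G o).le_topologicalClosure h

/-- The closure of the finitely supported functions does not depend on the base point, because the
norms for different base points induce the same convergence of sequences. -/
theorem mem_closedD0_iff {u : G.EnergySpace o} : u ∈ closedD0 G o ↔ u.fn ∈ G.D0 := by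
  constructor
  · intro h
    refine ⟨u.fn_mem, fun o' => ?_⟩
    obtain ⟨φ, hφ, ht⟩ := mem_closedD0_iff_seq.1 h
    refine (mem_closure_iff_seq_limit (X := G.EnergySpace o')).2 ⟨fun n => mk (φ n).fn (φ n).fn_mem, hφ, ?_⟩
    refine tendsto_iff ?_ (tendsto_apply ht o')
    have h1 : Tendsto (fun n => ‖φ n - u‖ ^ 2) atTop (𝓝 0) := by
      simpa using (tendsto_iff_norm_sub_tendsto_zero.1 ht).pow 2
    refine squeeze_zero (fun n => form_self_nonneg _) (fun n => ?_) h1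
    rw [form_apply]
    exact energyInner_self_le (φ n - u)
  · rintro ⟨_, h⟩
    exact h o

/-- If `φₙ(o) = 1` and the energies of `φₙ` tend to `0`, then `φₙ → 1` pointwise. The killing term
`c` vanishes because `c(y) φₙ(y)²` is at most the energy of `φₙ`. -/
theorem killing_eq_zero_of_tendsto {φ : ℕ → G.EnergySpace o} (ho : ∀ n, (φ n).fn o = 1)
    (hQ : Tendsto (fun n => form G o (φ n) (φ n)) atTop (𝓝 0)) (y : X) : G.c y = 0 := by
  have hpt : Tendsto (fun n => (φ n).fn y) atTop (𝓝 1) := by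
    obtain ⟨C, hC, h⟩ := G.exists_sq_sub_le y o
    have h2 : Tendsto (fun n => ((φ n).fn y - 1) ^ 2) atTop (𝓝 0) := by
      refine squeeze_zero (fun n => sq_nonneg _) (fun n => ?_)
        (by simpa only [mul_zero] using hQ.const_mul C)
      have := h _ (φ n).fn_mem
      rwa [ho, ← form_apply] at this
    have h3 : Tendsto (fun n => |(φ n).fn y - 1|) atTop (𝓝 0) := by
      simpa [Real.sqrt_sq_eq_abs] using h2.sqrt
    simpa using ((tendsto_zero_iff_abs_tendsto_zero _).2 h3).add_const 1
  refine le_antisymm ?_ (G.c_nonneg y)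
  have h2 : Tendsto (fun n => G.c y * (φ n).fn y ^ 2) atTop (𝓝 (G.c y)) := by
    simpa using (hpt.pow 2).const_mul (G.c y)
  refine le_of_tendsto_of_tendsto' h2 hQ fun n => ?_
  rw [form_apply]
  exact G.c_mul_sq_le (φ n).fn_mem y

/-- If `φₙ ∈ D₀` with `φₙ(o) = 1` have energies tending to `0`, then they converge to the constant
function `1`, which therefore lies in `D₀` and has energy `0`. -/
theorem not_isTransient_of_tendsto {φ : ℕ → G.EnergySpace o} (hφ : ∀ n, φ n ∈ closedD0 G o)
    (ho : ∀ n, (φ n).fn o = 1)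
    (hQ : Tendsto (fun n => form G o (φ n) (φ n)) atTop (𝓝 0)) : ¬ G.IsTransient := by
  intro hG
  have hc : ∀ y, G.c y = 0 := killing_eq_zero_of_tendsto ho hQ
  have h1e : G.energy 1 = 0 := by simp [energy, hc]
  have h1m : (1 : X → ℝ) ∈ G.finiteEnergy := by
    change G.energy 1 < ∞
    simp [h1e]
  obtain ⟨e, he⟩ : ∃ e : G.EnergySpace o, e.fn = 1 := ⟨mk 1 h1m, rfl⟩
  have hlim : Tendsto φ atTop (𝓝 e) := by
    refine tendsto_iff (hQ.congr fun n => ?_) (by simp [ho, he])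
    rw [form_apply, form_apply, fn_sub, he]
    simp [energyInner, hc]
  have hmem : e ∈ closedD0 G o :=
    (finiteSupport G o).isClosed_topologicalClosure.mem_of_tendsto hlim (.of_forall hφ)
  have h0 : e.fn = 0 := hG e.fn (mem_closedD0_iff.1 hmem) (by rw [he, h1e])
  have := congrFun (he.symm.trans h0) o
  simp at this

/-- On a transient graph the energy controls the value at the base point on `D₀`. -/
theorem exists_sq_base_le_form (hG : G.IsTransient) (o : X) : ∃ K : ℝ, 0 ≤ K ∧
    ∀ φ ∈ closedD0 G o, φ.fn o ^ 2 ≤ K * form G o φ φ := by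
  by_contra! hcon
  have h1 : ∀ n : ℕ, ∃ φ ∈ closedD0 G o, φ.fn o = 1 ∧ form G o φ φ ≤ 1 / ((n : ℝ) + 1) := by
    intro n
    obtain ⟨φ, hφ, h⟩ := hcon ((n : ℝ) + 1) (by positivity)
    have h0 : 0 < φ.fn o ^ 2 :=
      (mul_nonneg (by positivity) (form_self_nonneg φ)).trans_lt h
    have hne : φ.fn o ≠ 0 := fun h' => by simp [h'] at h0
    refine ⟨(φ.fn o)⁻¹ • φ, (closedD0 G o).smul_mem _ hφ, by simp [hne], ?_⟩
    simp only [map_smul, smul_apply, smul_eq_mul]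
    rw [← mul_assoc, ← mul_inv, ← pow_two, ← div_eq_inv_mul, div_le_div_iff₀ h0 (by positivity)]
    linarith
  choose φ hφ ho hQ using h1
  exact not_isTransient_of_tendsto hφ ho (squeeze_zero (fun n => form_self_nonneg _) hQ
    tendsto_one_div_add_atTop_nhds_zero_nat) hG

/-- On `D₀` of a transient graph the energy form is coercive, so every bounded functional is
represented by it. -/
theorem exists_form_eq (hG : G.IsTransient) (l : G.EnergySpace o →L[ℝ] ℝ) :
    ∃ u ∈ closedD0 G o, ∀ φ ∈ closedD0 G o, form G o u φ = l φ := by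
  have : CompleteSpace (closedD0 G o) :=
    (finiteSupport G o).isClosed_topologicalClosure.completeSpace_coe
  let B : closedD0 G o →L[ℝ] closedD0 G o →L[ℝ] ℝ :=
    (form G o).bilinearComp (closedD0 G o).subtypeL (closedD0 G o).subtypeL
  have hB : IsCoercive B := by
    obtain ⟨K, hK, h⟩ := exists_sq_base_le_form hG o
    refine ⟨(K + 1)⁻¹, by positivity, fun u => ?_⟩
    have h1 := h u u.2
    have h2 : ‖u‖ * ‖u‖ = form G o u u + (u : G.EnergySpace o).fn o ^ 2 := by
      rw [← norm_sq_eq_form, pow_two]; rfl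
    change (K + 1)⁻¹ * ‖u‖ * ‖u‖ ≤ form G o u u
    rw [mul_assoc, h2, inv_mul_le_iff₀ (by positivity)]
    linarith
  let r : closedD0 G o := (InnerProductSpace.toDual ℝ (closedD0 G o)).symm
    (l.comp (closedD0 G o).subtypeL)
  refine ⟨hB.continuousLinearEquivOfBilin.symm r, Subtype.mem _, fun φ hφ => ?_⟩
  have h1 := hB.continuousLinearEquivOfBilin_apply (hB.continuousLinearEquivOfBilin.symm r) ⟨φ, hφ⟩
  rw [ContinuousLinearEquiv.apply_symm_apply] at h1
  have h2 : inner ℝ r ⟨φ, hφ⟩ = l φ := InnerProductSpace.toDual_symm_apply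
  rw [← h2, h1]
  rfl

theorem exists_green (hG : G.IsTransient) (x : X) :
    ∃ g ∈ closedD0 G o, ∀ φ ∈ closedD0 G o, form G o g φ = φ.fn x :=
  exists_form_eq hG (evalCLM G o x)

theorem exists_sq_apply_le_form (hG : G.IsTransient) (x : X) : ∃ K : ℝ, 0 ≤ K ∧
    ∀ φ ∈ closedD0 G o, φ.fn x ^ 2 ≤ K * form G o φ φ := by
  obtain ⟨C, hC, h⟩ := exists_sq_apply_le (G := G) o x
  obtain ⟨K, hK, h'⟩ := exists_sq_base_le_form hG o
  refine ⟨C * (1 + K), by positivity, fun φ hφ => (h φ).trans ?_⟩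
  rw [mul_assoc, norm_sq_eq_form]
  gcongr
  linarith [h' φ hφ]

/-- Convergence in energy is convergence in `D₀`, for a transient graph. -/
theorem tendsto_of_form (hG : G.IsTransient) {ι : Type*} {l : Filter ι} {u : ι → G.EnergySpace o}
    {f : G.EnergySpace o} (hu : ∀ i, u i ∈ closedD0 G o) (hf : f ∈ closedD0 G o)
    (h : Tendsto (fun i => form G o (u i - f) (u i - f)) l (𝓝 0)) : Tendsto u l (𝓝 f) := by
  obtain ⟨K, hK, hK'⟩ := exists_sq_base_le_form hG o
  rw [tendsto_iff_norm_sub_tendsto_zero]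
  have h3 : Tendsto (fun i => ‖u i - f‖ ^ 2) l (𝓝 0) := by
    refine squeeze_zero (fun i => sq_nonneg _) (fun i => ?_) (by simpa only [mul_zero] using h.const_mul (1 + K))
    have := hK' _ ((closedD0 G o).sub_mem (hu i) hf)
    rw [norm_sq_eq_form, add_mul, one_mul]
    exact add_le_add_right this _
  simpa using h3.sqrt

/-! ### Bounded approximation and truncation -/

/-- The Green function `g` at `x` is a limit of finitely supported functions that are uniformly
bounded above. Cutting approximants `φₙ` at height `g(x)` does not increase their energy, and
`Q̃(min φₙ g(x) - g) = Q̃(min φₙ g(x)) - 2 min (φₙ x) g(x) + g(x)` tends to `0`. -/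
theorem exists_green_approx (hG : G.IsTransient) (x : X) :
    ∃ g ∈ closedD0 G o, (∀ φ ∈ closedD0 G o, form G o g φ = φ.fn x) ∧
    ∃ C : ℝ, 0 ≤ C ∧ ∃ ψ : ℕ → G.EnergySpace o, (∀ n, (ψ n).fn.support.Finite) ∧
      (∀ n y, (ψ n).fn y ≤ C) ∧ Tendsto ψ atTop (𝓝 g) := by
  obtain ⟨g, hg, hgr⟩ := exists_green (o := o) hG x
  have hC : 0 ≤ g.fn x := by rw [← hgr g hg]; exact form_self_nonneg g
  obtain ⟨φ, hφ, hlim⟩ := mem_closedD0_iff_seq.1 hg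
  have hcut : ∀ n, ∃ ψ : G.EnergySpace o, (∀ y, ψ.fn y = min ((φ n).fn y) (g.fn x)) ∧
      form G o ψ ψ ≤ form G o (φ n) (φ n) ∧ ψ.fn.support.Finite := fun n => by
    obtain ⟨h1, h2⟩ := G.energyInner_self_mono (g := fun y => min ((φ n).fn y) (g.fn x))
      (φ n).fn_mem
      (fun a b => by simpa using abs_min_sub_min_le_max ((φ n).fn a) (g.fn x) ((φ n).fn b) (g.fn x))
      (fun a => by
        have := abs_min_sub_min_le_max ((φ n).fn a) (g.fn x) 0 (g.fn x)
        simpa [min_eq_left hC] using this)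
    refine ⟨mk _ h1, fun y => rfl, by rwa [form_apply, form_apply], ?_⟩
    refine Set.Finite.subset (hφ n) fun y hy => ?_
    contrapose! hy
    simp only [Function.notMem_support, fn_mk] at hy ⊢
    rw [hy, min_eq_left hC]
  choose ψ hψ hle hsupp using hcut
  refine ⟨g, hg, hgr, g.fn x, hC, ψ, hsupp, fun n y => (hψ n y).trans_le (min_le_right _ _),
    tendsto_of_form hG (fun n => mem_closedD0_of_finite (hsupp n)) hg ?_⟩
  have h1 : Tendsto (fun n => form G o (φ n) (φ n) - 2 * min ((φ n).fn x) (g.fn x) + g.fn x)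
      atTop (𝓝 0) := by
    have h2 : Tendsto (fun n => form G o (φ n) (φ n)) atTop (𝓝 (form G o g g)) :=
      tendsto_form_self hlim
    have h3 := ((tendsto_apply hlim x).min (tendsto_const_nhds (x := g.fn x))).const_mul 2
    have h4 := (h2.sub h3).add_const (g.fn x)
    rw [hgr g hg, min_self] at h4
    convert h4 using 2
    ring
  refine squeeze_zero (fun n => form_self_nonneg _) (fun n => ?_) h1
  rw [form_self_sub, form_comm _ g, hgr _ (mem_closedD0_of_finite (hsupp n)), hgr g hg, hψ]
  gcongr
  exact hle n

/-- The truncation of a function to values in `[-M, M]`. -/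
def trunc (M : ℝ) (f : X → ℝ) (x : X) : ℝ := max (-M) (min (f x) M)

theorem abs_trunc_sub_le (M : ℝ) (f g : X → ℝ) (x y : X) :
    |trunc M f x - trunc M g y| ≤ |f x - g y| := by
  refine (abs_max_sub_max_le_max _ _ _ _).trans ?_
  simpa using abs_min_sub_min_le_max (f x) M (g y) M

theorem trunc_eq_self {M : ℝ} {f : X → ℝ} {x : X} (h : |f x| ≤ M) : trunc M f x = f x := by
  rw [trunc, min_eq_left (abs_le.1 h).2, max_eq_right (abs_le.1 h).1]

theorem abs_trunc_le {M : ℝ} (hM : 0 ≤ M) (f : X → ℝ) (x : X) : |trunc M f x| ≤ M :=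
  abs_le.2 ⟨le_max_left _ _, max_le (by linarith) (min_le_right _ _)⟩

theorem abs_trunc_le_abs {M : ℝ} (hM : 0 ≤ M) (f : X → ℝ) (x : X) : |trunc M f x| ≤ |f x| := by
  have h := abs_trunc_sub_le M f 0 x x
  rwa [trunc_eq_self (f := 0) (by simpa using hM), Pi.zero_apply, sub_zero, sub_zero] at h

theorem trunc_mem {M : ℝ} (hM : 0 ≤ M) {f : X → ℝ} (hf : f ∈ G.finiteEnergy) :
    trunc M f ∈ G.finiteEnergy ∧ G.energyInner (trunc M f) (trunc M f) ≤ G.energyInner f f :=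
  G.energyInner_self_mono hf (fun x y => abs_trunc_sub_le M f f x y) (abs_trunc_le_abs hM f)

/-! ### The Royden decomposition -/

/-- The Royden decomposition `f = f₀ + h` with `f₀ ∈ D₀` and `h` orthogonal to `D₀`. If `|f| ≤ M`
then `|h| ≤ M`: for finitely supported `φₙ → f₀`, truncating `f - φₙ` changes it by a finitely
supported function and does not increase its energy, so that the truncations form a minimizing
sequence in `f + D₀` and hence converge to the minimizer `h`. -/
theorem exists_royden_decomposition (hG : G.IsTransient) (f : G.EnergySpace o) :
    ∃ f₀ ∈ closedD0 G o, ∃ h : G.EnergySpace o, f = f₀ + h ∧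
      (∀ φ ∈ closedD0 G o, form G o h φ = 0) ∧ ∀ M, (∀ x, |f.fn x| ≤ M) → ∀ x, |h.fn x| ≤ M := by
  obtain ⟨f₀, hf₀, hr⟩ := exists_form_eq hG (form G o f)
  have horth : ∀ φ ∈ closedD0 G o, form G o (f - f₀) φ = 0 := fun φ hφ => by
    simp [hr φ hφ]
  refine ⟨f₀, hf₀, f - f₀, by abel, horth, fun M hM x => ?_⟩
  have hM0 : 0 ≤ M := (abs_nonneg _).trans (hM o)
  obtain ⟨φ, hφ, hlim⟩ := mem_closedD0_iff_seq.1 hf₀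
  set t : ℕ → G.EnergySpace o := fun n => mk (trunc M (f - φ n).fn) (trunc_mem hM0 (fn_mem _)).1
    with ht
  have hψ : ∀ n, f - t n ∈ closedD0 G o := fun n => by
    refine mem_closedD0_of_finite (Set.Finite.subset (hφ n) fun y hy => ?_)
    contrapose! hy
    simp only [Function.notMem_support] at hy ⊢
    have h1 : (f - φ n).fn y = f.fn y := by simp [hy]
    have h2 : trunc M (f - φ n).fn y = f.fn y := by
      rw [trunc_eq_self (by rw [h1]; exact hM y), h1]
    rw [ht, fn_sub, fn_mk, Pi.sub_apply, h2, sub_self]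
  have hconv : Tendsto (fun n => f - t n) atTop (𝓝 f₀) := by
    refine tendsto_of_form hG hψ hf₀ ?_
    have h1 : Tendsto (fun n => form G o (f - φ n) (f - φ n) - form G o (f - f₀) (f - f₀))
        atTop (𝓝 0) := by
      have h2 : Tendsto (fun n => f - φ n) atTop (𝓝 (f - f₀)) := hlim.const_sub f
      have h3 := tendsto_form_self h2
      simpa using h3.sub_const (form G o (f - f₀) (f - f₀))
    refine squeeze_zero (fun n => form_self_nonneg _) (fun n => ?_) h1
    have h2 : form G o (t n) (t n) ≤ form G o (f - φ n) (f - φ n) := by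
      rw [form_apply, form_apply]
      exact (trunc_mem hM0 (fn_mem _)).2
    have h3 : t n = (f - f₀) - (f - t n - f₀) := by abel
    rw [h3, form_self_sub, horth _ ((closedD0 G o).sub_mem (hψ n) hf₀)] at h2
    linarith
  have h1 : Tendsto (fun n => (t n).fn x) atTop (𝓝 ((f - f₀).fn x)) := by
    simpa using (tendsto_apply hconv x).const_sub (f.fn x)
  exact le_of_tendsto h1.abs (.of_forall fun n => abs_trunc_le hM0 _ x)

/-! ### Harmonicity of the orthogonal part -/

/-- Testing orthogonality against the indicator of a vertex `x` yields the equation of harmonicity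
at `x`. -/
theorem isHarmonic_of_form_eq_zero {h : G.EnergySpace o} {M : ℝ} (hM : ∀ x, |h.fn x| ≤ M)
    (horth : ∀ φ ∈ closedD0 G o, form G o h φ = 0) : G.IsHarmonic h.fn := by
  classical
  refine ⟨fun x => ?_, fun x => ?_⟩
  · refine Summable.of_nonneg_of_le (fun y => mul_nonneg (G.b_nonneg _ _) (abs_nonneg _))
      (fun y => ?_) ((G.b_summable x).mul_right M)
    exact mul_le_mul_of_nonneg_left (hM y) (G.b_nonneg _ _)
  have hs : Summable fun y => G.b x y * (h.fn x - h.fn y) := by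
    refine Summable.of_norm_bounded ((G.b_summable x).mul_right (M + M)) fun y => ?_
    rw [norm_mul, Real.norm_of_nonneg (G.b_nonneg _ _), Real.norm_eq_abs]
    exact mul_le_mul_of_nonneg_left ((abs_sub _ _).trans (add_le_add (hM x) (hM y)))
      (G.b_nonneg _ _)
  have hfin : (Pi.single x 1 : X → ℝ).support.Finite :=
    (Set.finite_singleton x).subset Pi.support_single_subset
  have h0 := horth (mk (Pi.single x 1) (G.mem_finiteEnergy_of_finite_support hfin))
    (mem_closedD0_of_finite hfin)
  rw [form_apply, fn_mk, energyInner] at h0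
  set δ : X → ℝ := Pi.single x 1 with hδ
  have hF : HasSum (fun p : X × X => G.b p.1 p.2 * (h.fn p.1 - h.fn p.2) * δ p.1)
      (∑' y, G.b x y * (h.fn x - h.fn y)) := by
    have hinj : Function.Injective (fun y : X => (x, y)) := fun a b hab => (Prod.mk.inj hab).2
    refine (hinj.hasSum_iff fun p hp => ?_).1 ?_
    · have : p.1 ≠ x := fun hx => hp ⟨p.2, by rw [← hx]⟩
      simp [hδ, this]
    · simpa [hδ, Function.comp_def] using hs.hasSum
  have hF' := (Equiv.prodComm X X).hasSum_iff.2 hF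
  have hb := (hF.add hF').tsum_eq
  have hc : ∑' y, G.c y * h.fn y * δ y = G.c x * h.fn x := by
    rw [tsum_eq_single x fun y hy => by simp [hδ, hy]]
    simp [hδ]
  rw [hc] at h0
  rw [← h0, add_left_inj, eq_inv_mul_iff_mul_eq₀ two_ne_zero, two_mul, ← hb]
  refine tsum_congr fun p => ?_
  simp only [Function.comp_apply, Equiv.prodComm_apply, Prod.fst_swap, Prod.snd_swap,
    G.b_symm p.2 p.1]
  ring

/-! ### The trace inequality -/

theorem sq_mem {u : X → ℝ} (hu : u ∈ G.finiteEnergy) {M : ℝ} (hM : ∀ x, |u x| ≤ M) :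
    (fun x => u x ^ 2) ∈ G.finiteEnergy := by
  have h1 : (2 * M) • u ∈ G.finiteEnergy := G.finiteEnergy.smul_mem _ hu
  refine (G.energyInner_self_mono h1 (fun x y => ?_) (fun x => ?_)).1
  · have hM0 : 0 ≤ M := (abs_nonneg _).trans (hM x)
    rw [Pi.smul_apply, Pi.smul_apply, smul_eq_mul, smul_eq_mul, ← mul_sub, abs_mul,
      abs_of_nonneg (by positivity : 0 ≤ 2 * M), sq_sub_sq, abs_mul]
    refine mul_le_mul_of_nonneg_right ?_ (abs_nonneg _)
    linarith [abs_add_le (u x) (u y), hM x, hM y]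
  · have hM0 : 0 ≤ M := (abs_nonneg _).trans (hM x)
    rw [Pi.smul_apply, smul_eq_mul, abs_mul, abs_of_nonneg (by positivity : 0 ≤ 2 * M), pow_two,
      abs_mul]
    refine mul_le_mul_of_nonneg_right ?_ (abs_nonneg _)
    linarith [hM x]

/-- The product rule
`2 Q̃(ψu, u) - Q̃(ψ, u²) = ½ ∑ b(x,y) (ψ(x) + ψ(y)) (u(x) - u(y))² + ∑ c(x) ψ(x) u(x)²`,
estimated by means of an upper bound of `ψ`. -/
theorem two_mul_energyInner_sub_le {ψ u : X → ℝ} {C : ℝ} (hψ : ψ ∈ G.finiteEnergy)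
    (hu : u ∈ G.finiteEnergy) (hu2 : (fun x => u x ^ 2) ∈ G.finiteEnergy)
    (hψu : (fun x => ψ x * u x) ∈ G.finiteEnergy) (hC : 0 ≤ C) (hle : ∀ x, ψ x ≤ C) :
    2 * G.energyInner (fun x => ψ x * u x) u - G.energyInner ψ (fun x => u x ^ 2) ≤
      2 * C * G.energyInner u u := by
  have key : ∀ {ι : Type _} {α β δ : ι → ℝ}, Summable α → Summable β → Summable δ →
      (∀ i, 2 * α i - β i ≤ 2 * C * δ i) → 2 * ∑' i, α i - ∑' i, β i ≤ 2 * C * ∑' i, δ i := by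
    intro ι α β δ hα hβ hδ h
    rw [← tsum_mul_left, ← tsum_mul_left, ← (hα.mul_left 2).tsum_sub hβ]
    exact ((hα.mul_left 2).sub hβ).tsum_le_tsum h (hδ.mul_left _)
  have hb := key (G.summable_b_mul hψu hu) (G.summable_b_mul hψ hu2) (G.summable_b_mul hu hu)
    fun p => by
      have h1 : (ψ p.1 + ψ p.2) * (G.b p.1 p.2 * (u p.1 - u p.2) ^ 2) ≤
          (C + C) * (G.b p.1 p.2 * (u p.1 - u p.2) ^ 2) :=
        mul_le_mul_of_nonneg_right (add_le_add (hle _) (hle _))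
          (mul_nonneg (G.b_nonneg _ _) (sq_nonneg _))
      linear_combination h1
  have hc := key (G.summable_c_mul hψu hu) (G.summable_c_mul hψ hu2) (G.summable_c_mul hu hu)
    fun x => by
      have h0 : 0 ≤ G.c x * u x ^ 2 := mul_nonneg (G.c_nonneg _) (sq_nonneg _)
      have h1 : ψ x * (G.c x * u x ^ 2) ≤ C * (G.c x * u x ^ 2) :=
        mul_le_mul_of_nonneg_right (hle _) h0
      have h2 : 0 ≤ C * (G.c x * u x ^ 2) := mul_nonneg hC h0
      linear_combination h1 + h2
  simp only [energyInner]
  linear_combination 2⁻¹ * hb + hc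

/-- If `u` is orthogonal to `D₀` and `w₀` is the `D₀`-part of `w = u²`, then
`w₀(x) = Q̃(g, u²)` for the Green function `g` at `x`, and the product rule for finitely supported
`ψ` close to `g` bounds `-Q̃(ψ, u²)`, since `Q̃(ψu, u) = 0`. -/
theorem exists_le_energy_of_orthogonal (hG : G.IsTransient) (x : X) : ∃ C : ℝ, 0 ≤ C ∧
    ∀ u w : G.EnergySpace o, (∀ φ ∈ closedD0 G o, form G o u φ = 0) →
      (∀ y, w.fn y = u.fn y ^ 2) → ∀ w₀ ∈ closedD0 G o,
      (∀ φ ∈ closedD0 G o, form G o (w - w₀) φ = 0) → -w₀.fn x ≤ C * form G o u u := by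
  obtain ⟨g, hg, hgr, C, hC, ψ, hψ, hψC, hlim⟩ := exists_green_approx (o := o) hG x
  refine ⟨2 * C, by positivity, fun u w hu hw w₀ hw₀ horth => ?_⟩
  have hgw : w₀.fn x = form G o w g := by
    have h1 := horth g hg
    rw [map_sub, sub_apply, sub_eq_zero] at h1
    rw [h1, ← hgr w₀ hw₀, form_comm]
  have hwf : w.fn = fun y => u.fn y ^ 2 := funext hw
  have hlim' : Tendsto (fun n => -form G o w (ψ n)) atTop (𝓝 (-form G o w g)) :=
    (((form G o w).continuous.tendsto g).comp hlim).neg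
  rw [hgw]
  refine le_of_tendsto hlim' (.of_forall fun n => ?_)
  have hfin : (fun y => (ψ n).fn y * u.fn y).support.Finite :=
    (hψ n).subset (Function.support_mul_subset_left _ _)
  have hmem := G.mem_finiteEnergy_of_finite_support hfin
  have h0 := hu (mk _ hmem) (mem_closedD0_of_finite hfin)
  rw [form_comm, form_apply, fn_mk] at h0
  have h1 := two_mul_energyInner_sub_le (ψ n).fn_mem u.fn_mem (hwf ▸ w.fn_mem) hmem hC (hψC n)
  rw [h0, ← hwf] at h1
  rw [form_comm, form_apply, form_apply]
  linarith

/-- Every bounded `f` agrees modulo `D₀` with a bounded `u` whose square agrees modulo `D₀` with a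
bounded harmonic function `h`, and the value of `h` at a given vertex is controlled by `‖f‖²`. -/
theorem exists_harmonic_majorant (hG : G.IsTransient) (o x : X) : ∃ C : ℝ, 0 ≤ C ∧
    ∀ (f : G.EnergySpace o) (M : ℝ), (∀ y, |f.fn y| ≤ M) → ∃ u h : G.EnergySpace o,
      (∀ y, |u.fn y| ≤ M) ∧ (∀ y, |h.fn y| ≤ M ^ 2) ∧ G.IsHarmonic h.fn ∧
      f.fn - u.fn ∈ G.D0 ∧ (fun y => u.fn y ^ 2) - h.fn ∈ G.D0 ∧ h.fn x ≤ C * ‖f‖ ^ 2 := by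
  obtain ⟨C₁, hC₁, h₁⟩ := exists_sq_apply_le (G := G) o x
  obtain ⟨K, hK, h₂⟩ := exists_sq_apply_le_form (o := o) hG x
  obtain ⟨C, hC, h₃⟩ := exists_le_energy_of_orthogonal (o := o) hG x
  refine ⟨2 * C₁ + 2 * K + C, by positivity, fun f M hM => ?_⟩
  obtain ⟨f₀, hf₀, u, hfu, hu, hub⟩ := exists_royden_decomposition hG f
  have huM := hub M hM
  obtain ⟨w, hw⟩ : ∃ w : G.EnergySpace o, w.fn = fun y => u.fn y ^ 2 :=
    ⟨mk _ (sq_mem u.fn_mem huM), rfl⟩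
  obtain ⟨w₀, hw₀, h, hwh, hh, hhb⟩ := exists_royden_decomposition hG w
  have hhM : ∀ y, |h.fn y| ≤ M ^ 2 := hhb _ fun y => by
    rw [hw, abs_pow]
    exact pow_le_pow_left₀ (abs_nonneg _) (huM y) 2
  refine ⟨u, h, huM, hhM, isHarmonic_of_form_eq_zero hhM hh, ?_, ?_, ?_⟩
  · have : f.fn - u.fn = f₀.fn := by rw [hfu]; simp
    rw [this]
    exact mem_closedD0_iff.1 hf₀
  · have : (fun y => u.fn y ^ 2) - h.fn = w₀.fn := by rw [← hw, hwh]; simp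
    rw [this]
    exact mem_closedD0_iff.1 hw₀
  · have e1 := h₃ u w hu (fun y => congrFun hw y) w₀ hw₀
      (fun φ hφ => by rw [hwh, add_sub_cancel_left]; exact hh φ hφ)
    have e2 : u.fn x ^ 2 = w₀.fn x + h.fn x := by
      rw [← congrFun hw x, hwh]; rfl
    have e3 : f.fn x = f₀.fn x + u.fn x := by rw [hfu]; rfl
    have e4 : form G o f f = form G o f₀ f₀ + form G o u u := by
      rw [hfu, form_self_add, form_comm f₀ u, hu f₀ hf₀]; ring
    have e5 : form G o f f ≤ ‖f‖ ^ 2 := by rw [norm_sq_eq_form]; nlinarith [sq_nonneg (f.fn o)]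
    have e6 : 0 ≤ form G o f₀ f₀ := form_self_nonneg _
    have e7 : 0 ≤ form G o u u := form_self_nonneg _
    have e8 : u.fn x ^ 2 ≤ 2 * f.fn x ^ 2 + 2 * f₀.fn x ^ 2 := by
      rw [e3]; nlinarith [sq_nonneg (2 * f₀.fn x + u.fn x)]
    have e9 : K * form G o f₀ f₀ ≤ K * ‖f‖ ^ 2 := by gcongr; linarith
    have e10 : C * form G o u u ≤ C * ‖f‖ ^ 2 := by gcongr; linarith
    linarith [h₁ f, h₂ f₀ hf₀]

/-! ### Density of the bounded functions -/

/-- The truncations of `f` converge to `f`, by dominated convergence: `f` minus its truncation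
oscillates no more than `2 f`. -/
theorem tendsto_trunc (f : G.EnergySpace o) :
    Tendsto (fun n : ℕ => (mk (trunc n f.fn) (trunc_mem n.cast_nonneg f.fn_mem).1 :
      G.EnergySpace o)) atTop (𝓝 f) := by
  have hev : ∀ x, ∀ᶠ n : ℕ in atTop, trunc n f.fn x = f.fn x := fun x => by
    obtain ⟨N, hN⟩ := exists_nat_ge |f.fn x|
    filter_upwards [eventually_ge_atTop N] with n hn
    exact trunc_eq_self (hN.trans (by exact_mod_cast hn))
  refine tendsto_iff ?_ (tendsto_nhds_of_eventually_eq (hev o))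
  have hf := (G.energy_lt_top_iff f.fn).1 f.fn_mem
  have h1 : ∀ (n : ℕ) (x y : X),
      ((trunc n f.fn x - f.fn x) - (trunc n f.fn y - f.fn y)) ^ 2 ≤
        4 * (f.fn x - f.fn y) ^ 2 := fun n x y => by
    have h := sq_le_sq.2 (abs_trunc_sub_le n f.fn f.fn x y)
    nlinarith [sq_nonneg ((trunc n f.fn x - trunc n f.fn y) + (f.fn x - f.fn y))]
  have h2 : ∀ (n : ℕ) (x : X), (trunc n f.fn x - f.fn x) ^ 2 ≤ 4 * f.fn x ^ 2 := fun n x => by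
    have h := sq_le_sq.2 (abs_trunc_le_abs n.cast_nonneg f.fn x)
    nlinarith [sq_nonneg (trunc n f.fn x + f.fn x)]
  have hb := tendsto_tsum_of_dominated_convergence (𝓕 := atTop) (f := fun (n : ℕ) (p : X × X) =>
      G.b p.1 p.2 * ((trunc n f.fn p.1 - f.fn p.1) - (trunc n f.fn p.2 - f.fn p.2)) *
        ((trunc n f.fn p.1 - f.fn p.1) - (trunc n f.fn p.2 - f.fn p.2))) (g := fun _ => 0)
    (hf.1.mul_left 4) (fun p => by
      refine tendsto_nhds_of_eventually_eq ?_
      filter_upwards [hev p.1, hev p.2] with n e1 e2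
      simp [e1, e2])
    (.of_forall fun n p => by
      rw [mul_assoc, ← pow_two, Real.norm_of_nonneg (mul_nonneg (G.b_nonneg _ _) (sq_nonneg _))]
      linarith [mul_le_mul_of_nonneg_left (h1 n p.1 p.2) (G.b_nonneg p.1 p.2)])
  have hc := tendsto_tsum_of_dominated_convergence (𝓕 := atTop) (f := fun (n : ℕ) (x : X) =>
      G.c x * (trunc n f.fn x - f.fn x) * (trunc n f.fn x - f.fn x)) (g := fun _ => 0)
    (hf.2.mul_left 4) (fun x => by
      refine tendsto_nhds_of_eventually_eq ?_
      filter_upwards [hev x] with n e1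
      simp [e1])
    (.of_forall fun n x => by
      rw [mul_assoc, ← pow_two, Real.norm_of_nonneg (mul_nonneg (G.c_nonneg _) (sq_nonneg _))]
      linarith [mul_le_mul_of_nonneg_left (h2 n x) (G.c_nonneg x)])
  simp only [form_apply, energyInner, fn_sub, fn_mk, Pi.sub_apply]
  simpa only [tsum_zero, mul_zero, add_zero] using (hb.const_mul 2⁻¹).add hc

end EnergySpace

variable {G}

/-! ### Restriction to the harmonic boundary -/

theorem exists_bddFiniteEnergy_coe_eq {f : X → ℝ} (hf : f ∈ G.finiteEnergy) {M : ℝ}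
    (hM : ∀ x, |f x| ≤ M) :
    ∃ g : G.bddFiniteEnergy, ((g : lp (fun _ : X => ℝ) ∞) : X → ℝ) = f :=
  ⟨⟨⟨f, memℓp_infty ⟨M, by rintro _ ⟨x, rfl⟩; exact hM x⟩⟩, hf⟩, rfl⟩

/-- A character has norm at most `1`: otherwise some `a` with `‖a‖ < 1` is mapped to `1`, although
`aⁿ → 0`. The algebra need not be complete. -/
theorem abs_character_le {B : Type*} [NormedRing B] [NormedAlgebra ℝ B] {S : Subalgebra ℝ B}
    (z : WeakDual.characterSpace ℝ S) (a : S) : |z a| ≤ ‖(a : B)‖ := by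
  by_contra! h
  have h0 : 0 < |z a| := (norm_nonneg _).trans_lt h
  have hz : z ((z a)⁻¹ • a) = 1 := by
    rw [map_smul, smul_eq_mul, inv_mul_cancel₀ (abs_pos.1 h0)]
  have hn : ‖(z a)⁻¹ • (a : B)‖ < 1 := by
    rw [norm_smul, norm_inv, Real.norm_eq_abs, inv_mul_lt_one₀ h0]
    exact h
  have hlim : Tendsto (fun n : ℕ => ((z a)⁻¹ • a) ^ n) atTop (𝓝 (0 : S)) :=
    tendsto_subtype_rng.2 (by simpa using tendsto_pow_atTop_nhds_zero_of_norm_lt_one hn)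
  have h1 := ((map_continuous z).tendsto 0).comp hlim
  simp only [Function.comp_def, map_pow, hz, one_pow, map_zero] at h1
  exact one_ne_zero (tendsto_nhds_unique tendsto_const_nhds h1)

variable (G) in
/-- The inclusion of the Royden algebra `A` in `A⁺`. -/
def toPlus (f : G.roydenAlgebra) : G.roydenAlgebraPlus := ⟨f, Algebra.subset_adjoin f.2⟩

theorem coe_toPlus (f : G.roydenAlgebra) :
    (G.toPlus f : lp (fun _ : X => ℝ) ∞) = (f : lp (fun _ : X => ℝ) ∞) := rfl

theorem coe_toRoyden (f : G.bddFiniteEnergy) :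
    (G.toRoyden f : lp (fun _ : X => ℝ) ∞) = (f : lp (fun _ : X => ℝ) ∞) := rfl

theorem preTrace_apply (f : G.roydenAlgebra) (z : G.harmonicBoundary) :
    G.preTrace f z = z.1 (G.toPlus f) := rfl

theorem abs_preTrace_le (f : G.roydenAlgebra) (z : G.harmonicBoundary) :
    |G.preTrace f z| ≤ ‖(f : lp (fun _ : X => ℝ) ∞)‖ :=
  abs_character_le z.1 (G.toPlus f)

theorem preTrace_add (f g : G.roydenAlgebra) (z : G.harmonicBoundary) :
    G.preTrace (f + g) z = G.preTrace f z + G.preTrace g z :=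
  map_add z.1 (G.toPlus f) (G.toPlus g)

theorem preTrace_smul (r : ℝ) (f : G.roydenAlgebra) (z : G.harmonicBoundary) :
    G.preTrace (r • f) z = r * G.preTrace f z :=
  map_smul z.1 r (G.toPlus f)

theorem preTrace_eq_of_sub_mem_D0 {f g : G.bddFiniteEnergy}
    (h : ((f : lp (fun _ : X => ℝ) ∞) : X → ℝ) - (g : lp (fun _ : X => ℝ) ∞) ∈ G.D0)
    (z : G.harmonicBoundary) :
    G.preTrace (G.toRoyden f) z = G.preTrace (G.toRoyden g) z := by
  have h1 := z.2.2 (G.toPlus (G.toRoyden f) - G.toPlus (G.toRoyden g)) (by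
    rw [AddSubgroupClass.coe_sub, lp.coeFn_sub, coe_toPlus, coe_toPlus, coe_toRoyden, coe_toRoyden]
    exact h)
  rwa [map_sub, sub_eq_zero] at h1

theorem preTrace_eq_sq {f g : G.bddFiniteEnergy}
    (h : ∀ x, (g : lp (fun _ : X => ℝ) ∞) x = (f : lp (fun _ : X => ℝ) ∞) x ^ 2)
    (z : G.harmonicBoundary) :
    G.preTrace (G.toRoyden g) z = G.preTrace (G.toRoyden f) z ^ 2 := by
  have h1 : G.toPlus (G.toRoyden g) = G.toPlus (G.toRoyden f) * G.toPlus (G.toRoyden f) := by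
    refine Subtype.ext (lp.ext (funext fun x => ?_))
    rw [MulMemClass.coe_mul, lp.infty_coeFn_mul, Pi.mul_apply, coe_toPlus, coe_toPlus,
      coe_toRoyden, coe_toRoyden, h x, pow_two]
  rw [preTrace_apply, preTrace_apply, h1, map_mul, pow_two]

/-- The trace inequality: the square of the trace of `f` is the trace of a bounded harmonic
function `h`, whose integral is the value of `h` at the pole of the harmonic measure. -/
theorem exists_integral_preTrace_sq_le (hG : G.IsTransient) {μ : Measure G.harmonicBoundary}
    (hμ : G.IsHarmonicMeasure μ) (o : X) : ∃ C : ℝ, 0 ≤ C ∧ ∀ f : G.bddFiniteEnergy,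
      ∫ z, (G.preTrace (G.toRoyden f) z) ^ 2 ∂μ ≤ C * ‖G.toEnergySpace o f‖ ^ 2 := by
  obtain ⟨x, hx⟩ := hμ
  obtain ⟨C, hC, hmaj⟩ := EnergySpace.exists_harmonic_majorant hG o x
  refine ⟨C, hC, fun f => ?_⟩
  obtain ⟨u, h, huM, hhM, hharm, hfu, huh, hle⟩ := hmaj (G.toEnergySpace o f) _
    (fun y => lp.norm_apply_le_norm (by simp) (f : lp (fun _ : X => ℝ) ∞) y)
  have hsqM : ∀ y, |u.fn y ^ 2| ≤ ‖(f : lp (fun _ : X => ℝ) ∞)‖ ^ 2 := fun y => by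
    rw [abs_pow]
    exact pow_le_pow_left₀ (abs_nonneg _) (huM y) 2
  obtain ⟨u', hu'⟩ := exists_bddFiniteEnergy_coe_eq u.fn_mem huM
  obtain ⟨w', hw'⟩ := exists_bddFiniteEnergy_coe_eq (EnergySpace.sq_mem u.fn_mem huM) hsqM
  obtain ⟨h', hh'⟩ := exists_bddFiniteEnergy_coe_eq h.fn_mem hhM
  have htr : ∀ z, G.preTrace (G.toRoyden f) z ^ 2 = G.preTrace (G.toRoyden h') z := fun z => by
    rw [preTrace_eq_of_sub_mem_D0 (g := u') (by rw [hu']; exact hfu),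
      ← preTrace_eq_sq (f := u') (g := w') fun x => by rw [hw', hu'],
      preTrace_eq_of_sub_mem_D0 (f := w') (g := h') (by rw [hw', hh']; exact huh)]
  simp only [htr]
  rw [← hx.repr h' (hh'.symm ▸ hharm), hh']
  exact hle

/-! ### The trace operator -/

theorem memLp_preTrace {μ : Measure G.harmonicBoundary} [IsFiniteMeasure μ]
    (f : G.roydenAlgebra) : MemLp (G.preTrace f) 2 μ :=
  MemLp.of_bound (G.preTrace f).continuous.aestronglyMeasurable _
    (.of_forall fun z => abs_preTrace_le f z)

variable (G) in
/-- The restriction to the harmonic boundary, as a linear map from `D̃ ∩ ℓ^∞(X)` to `L²(μ)`. -/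
def preTraceLp (μ : Measure G.harmonicBoundary) [IsFiniteMeasure μ] :
    G.bddFiniteEnergy →ₗ[ℝ] Lp ℝ 2 μ where
  toFun f := (memLp_preTrace (G.toRoyden f)).toLp _
  map_add' f g := by
    rw [← MemLp.toLp_add]
    exact MemLp.toLp_congr _ _ (.of_forall fun z => preTrace_add (G.toRoyden f) (G.toRoyden g) z)
  map_smul' r f := by
    rw [RingHom.id_apply, ← MemLp.toLp_const_smul]
    exact MemLp.toLp_congr _ _ (.of_forall fun z => preTrace_smul r (G.toRoyden f) z)

theorem coeFn_preTraceLp (μ : Measure G.harmonicBoundary) [IsFiniteMeasure μ]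
    (f : G.bddFiniteEnergy) : G.preTraceLp μ f =ᵐ[μ] G.preTrace (G.toRoyden f) :=
  (memLp_preTrace (G.toRoyden f)).coeFn_toLp

theorem norm_preTraceLp_sq (μ : Measure G.harmonicBoundary) [IsFiniteMeasure μ]
    (f : G.bddFiniteEnergy) :
    ‖G.preTraceLp μ f‖ ^ 2 = ∫ z, (G.preTrace (G.toRoyden f) z) ^ 2 ∂μ := by
  rw [← real_inner_self_eq_norm_sq, L2.inner_def]
  refine integral_congr_ae ?_
  filter_upwards [coeFn_preTraceLp μ f] with z hz
  rw [hz, real_inner_self_eq_norm_sq, Real.norm_eq_abs, sq_abs]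

variable (G) in
/-- The inclusion of `D̃ ∩ ℓ^∞(X)` in `D̃`, as a linear map. -/
def toEnergySpaceLinear (o : X) : G.bddFiniteEnergy →ₗ[ℝ] G.EnergySpace o where
  toFun := G.toEnergySpace o
  map_add' _ _ := rfl
  map_smul' _ _ := rfl

theorem denseRange_toEnergySpace (o : X) : DenseRange (G.toEnergySpace o) := fun f =>
  mem_closure_of_tendsto (EnergySpace.tendsto_trunc f) (.of_forall fun n => by
    obtain ⟨g, hg⟩ := exists_bddFiniteEnergy_coe_eq
      (EnergySpace.trunc_mem n.cast_nonneg f.fn_mem).1 (EnergySpace.abs_trunc_le n.cast_nonneg f.fn)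
    exact ⟨g, EnergySpace.fn_injective hg⟩)

end

end WeightedGraph

theorem theorem2p13 {X : Type*} [Countable X] [Infinite X] (G : WeightedGraph X)
    (hG : G.IsTransient) (hne : G.harmonicBoundary.Nonempty)
    (μ : Measure G.harmonicBoundary) (hμ : G.IsHarmonicMeasure μ) (o : X) :
    (∃ C : ℝ, 0 ≤ C ∧ ∀ f : G.bddFiniteEnergy,
      ∫ z, (G.preTrace (G.toRoyden f) z) ^ 2 ∂μ ≤ C * ‖G.toEnergySpace o f‖ ^ 2) ∧
    ∃! Tr : G.EnergySpace o →L[ℝ] Lp ℝ 2 μ, ∀ f : G.bddFiniteEnergy,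
      ∀ᵐ z ∂μ, Tr (G.toEnergySpace o f) z = G.preTrace (G.toRoyden f) z := by
  have hbound := WeightedGraph.exists_integral_preTrace_sq_le hG hμ o
  refine ⟨hbound, ?_⟩
  have hfin : IsFiniteMeasure μ :=
    ⟨(hμ.choose_spec.mass_le_one).trans_lt ENNReal.one_lt_top⟩
  obtain ⟨C, hC, hCf⟩ := hbound
  have hdense : DenseRange (G.toEnergySpaceLinear o) := WeightedGraph.denseRange_toEnergySpace o
  have hnorm : ∀ f, ‖G.preTraceLp μ f‖ ≤ √C * ‖G.toEnergySpaceLinear o f‖ := fun f => by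
    refine le_of_sq_le_sq ?_ (by positivity)
    rw [WeightedGraph.norm_preTraceLp_sq, mul_pow, Real.sq_sqrt hC]
    exact hCf f
  refine ⟨(G.preTraceLp μ).extendOfNorm (G.toEnergySpaceLinear o), fun f => ?_, fun T hT => ?_⟩
  · have h := LinearMap.extendOfNorm_eq hdense ⟨_, hnorm⟩ f
    change ∀ᵐ z ∂μ, (G.preTraceLp μ).extendOfNorm (G.toEnergySpaceLinear o)
      (G.toEnergySpaceLinear o f) z = _
    rw [h]
    exact WeightedGraph.coeFn_preTraceLp μ f
  · refine (LinearMap.extendOfNorm_unique hdense _ hnorm T (LinearMap.ext fun f => ?_)).symm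
    exact Lp.ext (Filter.EventuallyEq.trans (hT f) (WeightedGraph.coeFn_preTraceLp μ f).symm)
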